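/- Let $n \ge 1$ be an integer, let $f:\mathbb{R}\to\mathbb{R}$ be continuous, and let $e:\mathbb{R}\to\mathbb{R}$ be continuous and $2\pi$-periodic. Put $F(x)=\int_0^x f(u)\,du$, and assume that the finite limits $F(\infty)=\lim_{x\to\infty}F(x)$ and $F(-\infty)=\lim_{x\to-\infty}F(x)$ exist and that $$F(-\infty)<F(x)<F(\infty)\quad\text{for all } x\in\mathbb{R}.$$ Let $$A_n=\int_0^{2\pi} e(t)\cos nt\,dt,\qquad B_n=\int_0^{2\pi} e(t)\sin nt\,dt .$$ Then the equation $$x''+f(x)\,x'+n^2x=e(t)$$ has a $2\pi$-periodic solution $x\in C^2(\mathbb{R})$ if and only if $$\sqrt{A_n^2+B_n^2}<2n\,\bigl(F(\infty)-F(-\infty)\bigr).$$ -/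

import Mathlib

/-- The antiderivative `F(x) = ∫₀ˣ f(u) du` of the damping coefficient `f`. -/
noncomputable def dampingPrimitive (f : ℝ → ℝ) (x : ℝ) : ℝ :=
  ∫ u in (0 : ℝ)..x, f u

/-- `A_n = ∫₀^{2π} e(t) cos(nt) dt` (not divided by `π`). -/
noncomputable def cosCoeff (e : ℝ → ℝ) (n : ℕ) : ℝ :=
  ∫ t in (0 : ℝ)..(2 * Real.pi), e t * Real.cos (n * t)

/-- `B_n = ∫₀^{2π} e(t) sin(nt) dt` (not divided by `π`). -/
noncomputable def sinCoeff (e : ℝ → ℝ) (n : ℕ) : ℝ :=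
  ∫ t in (0 : ℝ)..(2 * Real.pi), e t * Real.sin (n * t)

/-- `x` is a classical (twice continuously differentiable) `2π`-periodic solution of
`x'' + f(x) x' + n² x = e(t)` on the whole real line. -/
def IsPeriodicSolution (f e : ℝ → ℝ) (n : ℕ) (x : ℝ → ℝ) : Prop :=
  ContDiff ℝ 2 x ∧ Function.Periodic x (2 * Real.pi) ∧
    ∀ t : ℝ, deriv (deriv x) t + f (x t) * deriv x t + (n : ℝ) ^ 2 * x t = e t

/-! Write `F` for `dampingPrimitive f`. Necessity: testing a periodic solution against `cos (n t -
θ)` removes the linear part and gives `√(A² + B²) = n ∫ F(x) cos (n t - φ)`. As `F` lies strictly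
between its limits, the integral is below `∫ (F(∞) cos⁺ - F(-∞) cos⁻) = 2 (F(∞) - F(-∞))`.

Sufficiency: set `y = x' + F(x)` and `w = exp (i n t) (n x + i y)`. Then `w' = exp (i n t) (-n F(x)
+ i e)` is bounded, so an orbit from a large circle `|w| = r` has `n x ≈ r cos (n t - θ)`, and
`F(x)` is near one of its limits except where the cosine is small. By the gap in the hypothesis the
displacement over one period points inwards (`re_sub_mul_conj_neg_of_norm_eq`). A winding argument
(`exists_eq_zero_of_re_mul_conj_pos`) then gives a fixed point of the period map. Clamping the
argument of `F` makes the field Lipschitz without affecting the orbit found. -/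

/-! ### Zeros of planar vector fields. -/

/-- A continuous planar vector field on a closed disc which points outwards along the boundary
circle vanishes somewhere in the disc. -/
theorem exists_eq_zero_of_re_mul_conj_pos {v : ℂ → ℂ} {R : ℝ} (hR : 0 < R)
    (hv : ContinuousOn v (Metric.closedBall 0 R))
    (hb : ∀ z : ℂ, ‖z‖ = R → 0 < (v z * (starRingEnd ℂ) z).re) :
    ∃ z ∈ Metric.closedBall (0 : ℂ) R, v z = 0 := by
  by_contra! hne
  have hmax : ∀ z : ℂ, 0 < max R ‖z‖ := fun z => lt_max_of_lt_left hR
  have hmem : ∀ z : ℂ, z * ((R / max R ‖z‖ : ℝ) : ℂ) ∈ Metric.closedBall (0 : ℂ) R := by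
    intro z
    rw [mem_closedBall_zero_iff, norm_mul, Complex.norm_real, Real.norm_of_nonneg
      (div_nonneg hR.le (hmax z).le), ← mul_div_assoc, div_le_iff₀ (hmax z), mul_comm]
    exact mul_le_mul_of_nonneg_left (le_max_right _ _) hR.le
  have hret : Continuous fun z : ℂ => z * ((R / max R ‖z‖ : ℝ) : ℂ) := by
    refine continuous_id.mul (Complex.continuous_ofReal.comp ?_)
    exact continuous_const.div (continuous_const.max continuous_norm) fun z => (hmax z).ne'
  let V : C(ℂ, ℂ) := ⟨fun z => v (z * ((R / max R ‖z‖ : ℝ) : ℂ)), hv.comp_continuous hret hmem⟩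
  have hV : ∀ z, V z ≠ 0 := fun z => hne _ (hmem z)
  have hVb : ∀ z : ℂ, ‖z‖ = R → V z = v z := by
    intro z hz
    change v _ = _
    rw [hz, max_self, div_self hR.ne', Complex.ofReal_one, mul_one]
  -- Radial retraction made `V` a nonvanishing map on the simply connected plane, so it has a
  -- continuous logarithm `g`.
  obtain ⟨g, ⟨-, hg⟩, -⟩ := Complex.isCoveringMapOn_exp.existsUnique_continuousMap_lifts V
    (a₀ := 0) (e₀ := Complex.log (V 0)) (Complex.exp_log (hV 0)) hV
  have hg' : ∀ z, Complex.exp (g z) = V z := fun z => congrFun hg z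
  let c : ℝ → ℂ := fun θ => R * Complex.exp (θ * Complex.I)
  have hc : Continuous c := by fun_prop
  have hcn : ∀ θ, ‖c θ‖ = R := by
    intro θ
    simp [c, Complex.norm_exp_ofReal_mul_I, abs_of_pos hR]
  have hpos : ∀ θ, 0 < (V (c θ) * (starRingEnd ℂ) (c θ)).re := fun θ => by
    rw [hVb _ (hcn θ)]
    exact hb _ (hcn θ)
  -- The principal logarithm is continuous here, its argument having positive real part. `exp ∘ h`
  -- is constant, hence so is `h`; yet one turn preserves the first two terms and changes the last
  -- by `2πi`.
  let h : ℝ → ℂ := fun θ =>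
    g (c θ) - Complex.log (V (c θ) * (starRingEnd ℂ) (c θ)) - θ * Complex.I
  have hh : Continuous h := by
    refine ((g.continuous.comp hc).sub (Continuous.clog ?_ fun θ => Or.inl (hpos θ))).sub
      (by fun_prop)
    exact (V.continuous.comp hc).mul (Complex.continuous_conj.comp hc)
  have hexp : ∀ θ, Complex.exp (h θ) = (R : ℂ)⁻¹ := by
    intro θ
    have h0 : V (c θ) * (starRingEnd ℂ) (c θ) ≠ 0 := fun h0 => by
      have := hpos θ
      simp [h0] at this
    have hR' : (R : ℂ) ≠ 0 := by exact_mod_cast hR.ne'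
    have hconj : (starRingEnd ℂ) (c θ) = R * Complex.exp (-(θ * Complex.I)) := by
      simp [c, ← Complex.exp_conj]
    simp only [h]
    rw [Complex.exp_sub, Complex.exp_sub, hg', Complex.exp_log h0, hconj, Complex.exp_neg]
    have := hV (c θ)
    have := Complex.exp_ne_zero (θ * Complex.I)
    field_simp
  have hconst : h = fun _ => h 0 := by
    refine Complex.isCoveringMap_exp.eq_of_comp_eq hh continuous_const ?_ 0 rfl
    funext θ
    exact Subtype.ext ((hexp θ).trans (hexp 0).symm)
  have h2 : h (2 * Real.pi) = h 0 := congrFun hconst _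
  have hc2 : c (2 * Real.pi) = c 0 := by simp [c, Complex.exp_two_pi_mul_I]
  simp only [h, hc2] at h2
  have h3 := sub_right_injective h2
  simp at h3

/-! ### Trigonometric integrals and Fourier coefficients. -/

theorem integral_abs_cos_natCast_mul_sub {n : ℕ} (hn : 1 ≤ n) (θ : ℝ) :
    ∫ t in (0 : ℝ)..2 * Real.pi, |Real.cos (n * t - θ)| = 4 := by
  have hn0 : (n : ℝ) ≠ 0 := by positivity
  have hper : Function.Periodic (fun u => |Real.cos u|) Real.pi := fun u => by
    simp [Real.cos_add_pi]
  have hhalf : ∀ a, ∫ u in a..a + Real.pi, |Real.cos u| = 2 := by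
    intro a
    rw [hper.intervalIntegral_add_eq a (-(Real.pi / 2)),
      show -(Real.pi / 2) + Real.pi = Real.pi / 2 by ring]
    rw [intervalIntegral.integral_congr (g := Real.cos)]
    · rw [integral_cos]
      norm_num
    · intro u hu
      rw [Set.uIcc_of_le (by linarith [Real.pi_pos])] at hu
      exact abs_of_nonneg (Real.cos_nonneg_of_mem_Icc hu)
  have hFTC : ∀ a b, IntervalIntegrable (fun u => |Real.cos u|) MeasureTheory.volume a b :=
    fun a b => (Real.continuous_cos.abs).intervalIntegrable a b
  rw [intervalIntegral.integral_comp_mul_sub (fun u => |Real.cos u|) hn0]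
  -- After rescaling, the interval consists of `2n` periods of `|cos|`, each contributing `2`.
  have := hper.intervalIntegral_add_zsmul_eq (2 * n : ℤ) (n * 0 - θ) hFTC
  rw [hhalf, show n * 0 - θ + (2 * n : ℤ) • Real.pi = n * (2 * Real.pi) - θ by
    rw [zsmul_eq_mul]; push_cast; ring] at this
  rw [this]
  simp only [zsmul_eq_mul, smul_eq_mul]
  push_cast
  field_simp
  norm_num

theorem integral_cos_natCast_mul_sub {n : ℕ} (hn : 1 ≤ n) (θ : ℝ) :
    ∫ t in (0 : ℝ)..2 * Real.pi, Real.cos (n * t - θ) = 0 := by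
  have hn0 : (n : ℝ) ≠ 0 := by positivity
  rw [intervalIntegral.integral_comp_mul_sub Real.cos hn0, integral_cos,
    show n * (2 * Real.pi) - θ = n * 0 - θ + n * (2 * Real.pi) by ring,
    Real.sin_add_nat_mul_two_pi, sub_self, smul_zero]

/-- The integrand is `a (cos)⁺ - b (cos)⁻` evaluated at `n t - θ`. -/
theorem integral_weighted_abs_cos_add_cos {n : ℕ} (hn : 1 ≤ n) (a b θ : ℝ) :
    ∫ t in (0 : ℝ)..2 * Real.pi, ((a - b) / 2 * |Real.cos (n * t - θ)| +
      (a + b) / 2 * Real.cos (n * t - θ)) = 2 * (a - b) := by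
  rw [intervalIntegral.integral_add (Continuous.intervalIntegrable (by fun_prop) _ _)
    (Continuous.intervalIntegrable (by fun_prop) _ _), intervalIntegral.integral_const_mul,
    intervalIntegral.integral_const_mul, integral_abs_cos_natCast_mul_sub hn,
    integral_cos_natCast_mul_sub hn]
  ring

theorem integral_mul_cos_natCast_mul_sub {e : ℝ → ℝ} (he : Continuous e) (n : ℕ) (θ : ℝ) :
    ∫ t in (0 : ℝ)..2 * Real.pi, e t * Real.cos (n * t - θ) =
      cosCoeff e n * Real.cos θ + sinCoeff e n * Real.sin θ := by
  rw [cosCoeff, sinCoeff, ← intervalIntegral.integral_mul_const,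
    ← intervalIntegral.integral_mul_const, ← intervalIntegral.integral_add
    (Continuous.intervalIntegrable (by fun_prop) _ _)
    (Continuous.intervalIntegrable (by fun_prop) _ _)]
  refine intervalIntegral.integral_congr fun t _ => ?_
  simp only [Real.cos_sub]
  ring

theorem integral_mul_cos_le_sqrt {e : ℝ → ℝ} (he : Continuous e) (n : ℕ) (θ : ℝ) :
    ∫ t in (0 : ℝ)..2 * Real.pi, e t * Real.cos (n * t - θ) ≤
      Real.sqrt (cosCoeff e n ^ 2 + sinCoeff e n ^ 2) := by
  rw [integral_mul_cos_natCast_mul_sub he]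
  refine Real.le_sqrt_of_sq_le ?_
  nlinarith [sq_nonneg (cosCoeff e n * Real.sin θ - sinCoeff e n * Real.cos θ),
    Real.sin_sq_add_cos_sq θ]

theorem exists_integral_mul_cos_eq_sqrt {e : ℝ → ℝ} (he : Continuous e) (n : ℕ) :
    ∃ θ : ℝ, ∫ t in (0 : ℝ)..2 * Real.pi, e t * Real.cos (n * t - θ) =
      Real.sqrt (cosCoeff e n ^ 2 + sinCoeff e n ^ 2) := by
  let z : ℂ := ⟨cosCoeff e n, sinCoeff e n⟩
  refine ⟨z.arg, ?_⟩
  have hz : Real.sqrt (cosCoeff e n ^ 2 + sinCoeff e n ^ 2) = ‖z‖ := by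
    rw [Complex.norm_eq_sqrt_sq_add_sq]
  rw [integral_mul_cos_natCast_mul_sub he, hz]
  have h1 : cosCoeff e n = ‖z‖ * Real.cos z.arg := (Complex.norm_mul_cos_arg z).symm
  have h2 : sinCoeff e n = ‖z‖ * Real.sin z.arg := (Complex.norm_mul_sin_arg z).symm
  rw [h1, h2]
  linear_combination ‖z‖ * Real.sin_sq_add_cos_sq z.arg

/-! ### The damping primitive and orbits of planar fields. -/

theorem hasDerivAt_dampingPrimitive {f : ℝ → ℝ} (hf : Continuous f) (x : ℝ) :
    HasDerivAt (dampingPrimitive f) (f x) x :=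
  intervalIntegral.integral_hasDerivAt_right (hf.intervalIntegrable _ _)
    (hf.stronglyMeasurableAtFilter _ _) hf.continuousAt

theorem norm_sub_le_of_hasDerivWithinAt {G : ℝ → ℂ → ℂ} {T L : ℝ} (hL : ∀ t z, ‖G t z‖ ≤ L)
    {w : ℝ → ℂ} (hw : ∀ t ∈ Set.Icc 0 T, HasDerivWithinAt w (G t (w t)) (Set.Icc 0 T) t)
    {t : ℝ} (ht : t ∈ Set.Icc 0 T) : ‖w t - w 0‖ ≤ L * T := by
  have hL0 : 0 ≤ L := (norm_nonneg _).trans (hL 0 0)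
  have := norm_image_sub_le_of_norm_deriv_le_segment' hw (fun s _ => hL s (w s)) t ht
  rw [sub_zero] at this
  exact this.trans (mul_le_mul_of_nonneg_left ht.2 hL0)

/-- A bounded Lipschitz time-dependent planar vector field has, on `[0, T]`, an orbit returning
to its starting point, as soon as all orbits issued from some circle are displaced inwards. -/
theorem exists_orbit_return {G : ℝ → ℂ → ℂ} {T L r : ℝ} {K : NNReal} (hT : 0 ≤ T) (hr : 0 < r)
    (hG : Continuous fun p : ℝ × ℂ => G p.1 p.2) (hL : ∀ t z, ‖G t z‖ ≤ L)
    (hK : ∀ t, LipschitzWith K (G t))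
    (hin : ∀ w : ℝ → ℂ, ‖w 0‖ = r →
      (∀ t ∈ Set.Icc 0 T, HasDerivWithinAt w (G t (w t)) (Set.Icc 0 T) t) →
      ((w T - w 0) * (starRingEnd ℂ) (w 0)).re < 0) :
    ∃ w : ℝ → ℂ, ‖w 0‖ ≤ r ∧ w T = w 0 ∧
      ∀ t ∈ Set.Icc 0 T, HasDerivWithinAt w (G t (w t)) (Set.Icc 0 T) t := by
  have hL0 : 0 ≤ L := (norm_nonneg _).trans (hL 0 0)
  -- Starting in the disc of radius `r`, an orbit of speed at most `L` stays within radius `r + L *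
  -- T` up to time `T`.
  have hPL : IsPicardLindelof G (⟨0, le_rfl, hT⟩ : Set.Icc (0 : ℝ) T) (0 : ℂ)
      ⟨r + L * T, by positivity⟩ ⟨r, hr.le⟩ ⟨L, hL0⟩ K :=
    { lipschitzOnWith := fun t _ => (hK t).lipschitzOnWith
      continuousOn := fun z _ =>
        (hG.comp (continuous_id.prodMk continuous_const)).continuousOn
      norm_le := fun t _ z _ => hL t z
      mul_max_le := by
        change L * max (T - 0) (0 - 0) ≤ r + L * T - r
        rw [sub_zero, sub_zero, max_eq_left hT]
        linarith }
  obtain ⟨α, hα, hcont⟩ :=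
    hPL.exists_forall_mem_closedBall_eq_hasDerivWithinAt_continuousOn
  change ∀ x ∈ Metric.closedBall (0 : ℂ) r, α (x, 0) = x ∧ _ at hα
  change ContinuousOn α (Metric.closedBall (0 : ℂ) r ×ˢ Set.Icc 0 T) at hcont
  obtain ⟨z, hz, hz0⟩ := exists_eq_zero_of_re_mul_conj_pos (v := fun z => z - α (z, T)) hr
    (continuousOn_id.sub (hcont.comp (continuousOn_id.prodMk continuousOn_const)
      fun z hz => ⟨hz, hT, le_rfl⟩)) (by
      intro z hz
      have hzm : z ∈ Metric.closedBall (0 : ℂ) r := by simp [hz]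
      obtain ⟨h0, hd⟩ := hα z hzm
      have := hin (fun t => α (z, t)) (by rw [h0, hz]) hd
      simp only [h0] at this
      rw [← neg_sub, neg_mul, Complex.neg_re]
      linarith)
  obtain ⟨h0, hd⟩ := hα z hz
  exact ⟨fun t => α (z, t), by simpa [h0] using hz, by
    simpa [h0] using (sub_eq_zero.mp hz0).symm, hd⟩

/-- An orbit of a `T`-periodic vector field on `[0, T]` with equal endpoints extends to a
`T`-periodic orbit on the whole line. -/
theorem exists_periodic_orbit_of_return {G : ℝ → ℂ → ℂ} {T : ℝ} (hT : 0 < T)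
    (hG : Continuous fun p : ℝ × ℂ => G p.1 p.2) (hper : ∀ t z, G (t + T) z = G t z)
    {w : ℝ → ℂ} (hw : ∀ t ∈ Set.Icc 0 T, HasDerivWithinAt w (G t (w t)) (Set.Icc 0 T) t)
    (hret : w T = w 0) :
    ∃ W : ℝ → ℂ, Function.Periodic W T ∧ Set.EqOn W w (Set.Icc 0 T) ∧
      ∀ t, HasDerivAt W (G t (W t)) t := by
  have : Fact (0 < T) := ⟨hT⟩
  have hwc : ContinuousOn w (Set.Icc 0 T) := fun t ht => (hw t ht).continuousWithinAt
  let V : ℝ → ℂ := fun t => AddCircle.liftIco T 0 w (t : AddCircle T)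
  have hVc : Continuous V :=
    (AddCircle.liftIco_zero_continuous hret.symm hwc).comp (AddCircle.continuous_mk' T)
  have hVp : Function.Periodic V T := fun t => by simp [V]
  have hVw : Set.EqOn V w (Set.Icc 0 T) := by
    intro t ht
    rcases ht.2.lt_or_eq with h | h
    · exact AddCircle.liftIco_zero_coe_apply ⟨ht.1, h⟩
    · have : V (0 + T) = w T := by
        rw [hVp, hret]
        exact AddCircle.liftIco_zero_coe_apply ⟨le_rfl, hT⟩
      rwa [zero_add, ← h] at this
  have hgc : Continuous fun s => G s (V s) := hG.comp (continuous_id.prodMk hVc)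
  have hgp : Function.Periodic (fun s => G s (V s)) T := fun s => by
    simp only [hVp s, hper]
  -- Integrating along the periodic extension `V` gives differentiability also at the junction
  -- points; `W = V` follows by periodicity.
  let W : ℝ → ℂ := fun t => w 0 + ∫ s in (0 : ℝ)..t, G s (V s)
  have hWd : ∀ t, HasDerivAt W (G t (V t)) t := fun t =>
    (intervalIntegral.integral_hasDerivAt_right (hgc.intervalIntegrable _ _)
      (hgc.stronglyMeasurableAtFilter _ _) hgc.continuousAt).const_add _
  have hWw : Set.EqOn W w (Set.Icc 0 T) := by
    intro t ht
    have hsub : Set.uIcc 0 t ⊆ Set.Icc 0 T := by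
      rw [Set.uIcc_of_le ht.1]
      exact Set.Icc_subset_Icc le_rfl ht.2
    have : ∫ s in (0 : ℝ)..t, G s (V s) = w t - w 0 := by
      refine intervalIntegral.integral_eq_sub_of_hasDerivAt_of_le ht.1
        (hwc.mono (Set.Icc_subset_Icc le_rfl ht.2)) (fun s hs => ?_)
        (hgc.intervalIntegrable _ _)
      have hs' : s ∈ Set.Ioo 0 T := ⟨hs.1, hs.2.trans_le ht.2⟩
      rw [hVw (Set.Ioo_subset_Icc_self hs')]
      exact (hw s (Set.Ioo_subset_Icc_self hs')).hasDerivAt (Icc_mem_nhds hs'.1 hs'.2)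
    simp [W, this]
  have hWp : Function.Periodic W T := by
    intro t
    have h0 : ∫ s in (0 : ℝ)..0 + T, G s (V s) = 0 := by
      have := hWw (Set.right_mem_Icc.mpr hT.le)
      rw [hret] at this
      simpa [W] using this
    have := hgp.intervalIntegral_add_eq_add 0 t fun _ _ => hgc.intervalIntegrable _ _
    simp only [W, this, h0, add_zero]
  have hWV : W = V := by
    funext t
    obtain ⟨s, hs, h⟩ := (hWp.sub hVp).exists_mem_Ico₀ hT t
    have hs' := Set.Ico_subset_Icc_self hs
    rw [Pi.sub_apply, Pi.sub_apply, hWw hs', hVw hs', sub_self] at h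
    exact sub_eq_zero.mp h
  exact ⟨W, hWp, hWw, fun t => by rw [congrFun hWV t]; exact hWd t⟩

/-! ### Necessity. -/

theorem mul_lt_weighted_abs_add {a b y c : ℝ} (hb : b < y) (ha : y < a) (hc : c ≠ 0) :
    y * c < (a - b) / 2 * |c| + (a + b) / 2 * c := by
  rcases hc.lt_or_gt with h | h
  · rw [abs_of_neg h]
    nlinarith
  · rw [abs_of_pos h]
    nlinarith

theorem sqrt_lt_of_isPeriodicSolution {n : ℕ} (hn : 1 ≤ n) {f e : ℝ → ℝ}
    (hf : Continuous f) (he : Continuous e) {Fneg Fpos : ℝ}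
    (hF : ∀ x : ℝ, Fneg < dampingPrimitive f x ∧ dampingPrimitive f x < Fpos)
    {x : ℝ → ℝ} (hx : IsPeriodicSolution f e n x) :
    Real.sqrt (cosCoeff e n ^ 2 + sinCoeff e n ^ 2) < 2 * (n : ℝ) * (Fpos - Fneg) := by
  obtain ⟨hx2, hxp, hode⟩ := hx
  have hn0 : (0 : ℝ) < n := by positivity
  obtain ⟨θ, hθ⟩ := exists_integral_mul_cos_eq_sqrt he n
  set φ := θ + Real.pi / 2 with hφ
  have hsin : ∀ t, Real.sin (n * t - θ) = Real.cos (n * t - φ) := fun t => by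
    rw [hφ, ← sub_sub, Real.cos_sub_pi_div_two]
  have hd : ∀ t, HasDerivAt x (deriv x t) t := fun t =>
    (hx2.differentiable (by norm_num)).differentiableAt.hasDerivAt
  have hx1 : ContDiff ℝ 1 (deriv x) := ((contDiff_succ_iff_deriv (n := 1)).mp hx2).2.2
  have hd2 : ∀ t, HasDerivAt (deriv x) (deriv (deriv x) t) t := fun t =>
    (hx1.differentiable (by norm_num)).differentiableAt.hasDerivAt
  have hxc : Continuous x := hx2.continuous
  have hFc : Continuous (dampingPrimitive f) :=
    continuous_iff_continuousAt.mpr fun y => (hasDerivAt_dampingPrimitive hf y).continuousAt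
  have hlin : ∀ t, HasDerivAt (fun t : ℝ => n * t - θ) n t := fun t => by
    simpa using ((hasDerivAt_id t).const_mul (n : ℝ)).sub_const θ
  -- The terms in `x` and `x'` cancel in `Q'` because the cosine solves `u'' + n² u = 0`.
  let Q : ℝ → ℝ := fun t => deriv x t * Real.cos (n * t - θ) +
    n * x t * Real.sin (n * t - θ) + dampingPrimitive f (x t) * Real.cos (n * t - θ)
  have hQ : ∀ t, HasDerivAt Q (e t * Real.cos (n * t - θ) -
      n * (dampingPrimitive f (x t) * Real.cos (n * t - φ))) t := by
    intro t
    have h := (((hd2 t).mul (hlin t).cos).add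
      (((hd t).const_mul (n : ℝ)).mul (hlin t).sin)).add
      (((hasDerivAt_dampingPrimitive hf (x t)).comp t (hd t)).mul (hlin t).cos)
    refine h.congr_deriv ?_
    rw [← hode t, ← hsin, Function.comp_apply]
    ring
  have hQp : Q (2 * Real.pi) = Q 0 := by
    have h1 : deriv x (2 * Real.pi) = deriv x 0 := by
      have := deriv_comp_add_const x (2 * Real.pi) 0
      rwa [show (fun t => x (t + 2 * Real.pi)) = x from funext hxp, zero_add, eq_comm] at this
    have h2 : x (2 * Real.pi) = x 0 := by simpa using hxp 0
    have h3 : (n : ℝ) * (2 * Real.pi) - θ = n * 0 - θ + n * (2 * Real.pi) := by ring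
    simp only [Q, h1, h2, h3, Real.sin_add_nat_mul_two_pi, Real.cos_add_nat_mul_two_pi]
  have hFTC := intervalIntegral.integral_eq_sub_of_hasDerivAt (a := 0) (b := 2 * Real.pi)
    (fun t _ => hQ t) (Continuous.intervalIntegrable (by fun_prop) _ _)
  rw [hQp, sub_self, intervalIntegral.integral_sub
    (Continuous.intervalIntegrable (by fun_prop) _ _)
    (Continuous.intervalIntegrable (by fun_prop) _ _), intervalIntegral.integral_const_mul,
    hθ] at hFTC
  -- The pointwise bound is strict only where the cosine is nonzero; one such point makes the
  -- integral bound strict.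
  have hex : ∃ t ∈ Set.Icc 0 (2 * Real.pi), Real.cos (n * t - φ) ≠ 0 := by
    by_contra! h
    have h4 := integral_abs_cos_natCast_mul_sub hn φ
    rw [intervalIntegral.integral_congr (g := fun _ => (0 : ℝ))] at h4
    · simp at h4
    · intro t ht
      rw [Set.uIcc_of_le Real.two_pi_pos.le] at ht
      simp [h t ht]
  have hlt : ∫ t in (0 : ℝ)..2 * Real.pi, dampingPrimitive f (x t) * Real.cos (n * t - φ) <
      2 * (Fpos - Fneg) := by
    rw [← integral_weighted_abs_cos_add_cos hn Fpos Fneg φ]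
    refine intervalIntegral.integral_lt_integral_of_continuousOn_of_le_of_exists_lt
      Real.two_pi_pos (Continuous.continuousOn (by fun_prop))
      (Continuous.continuousOn (by fun_prop)) (fun t _ => ?_) ?_
    · by_cases hc : Real.cos (n * t - φ) = 0
      · simp [hc]
      · exact (mul_lt_weighted_abs_add (hF _).1 (hF _).2 hc).le
    · obtain ⟨t, ht, hc⟩ := hex
      exact ⟨t, ht, mul_lt_weighted_abs_add (hF _).1 (hF _).2 hc⟩
  nlinarith

/-! ### Sufficiency: the rotating field and its inward displacement. -/

/-- If `|c| ≤ δ`, the error is at most `(a - b) δ`. Otherwise `x` has the sign of `c` and `|x| ≥ κ`,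
so `Φ x` is within `ε` of the relevant limit. -/
theorem weighted_abs_add_sub_le_mul {Φ : ℝ → ℝ} {a b ε δ κ C r n x c : ℝ} (hn : 0 < n)
    (hΦ : ∀ y, b < Φ y ∧ Φ y < a) (hε : 0 ≤ ε) (hδ : 0 ≤ δ) (hpos : ∀ y, κ ≤ y → a - ε ≤ Φ y)
    (hneg : ∀ y, y ≤ -κ → Φ y ≤ b + ε) (hc : |c| ≤ 1) (hx : |n * x - r * c| ≤ C)
    (hr0 : 0 ≤ r) (hr : C + n * κ ≤ r * δ) :
    (a - b) / 2 * |c| + (a + b) / 2 * c - (ε + (a - b) * δ) ≤ Φ x * c := by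
  obtain ⟨hx1, hx2⟩ := abs_le.mp hx
  have hy := hΦ x
  have hab : 0 ≤ (a - b) * δ := mul_nonneg (by linarith) hδ
  rcases le_or_gt 0 c with h | h
  · rw [abs_of_nonneg h] at hc ⊢
    rcases le_or_gt c δ with h' | h'
    · nlinarith
    · have hk : κ ≤ x := le_of_mul_le_mul_left (by nlinarith) hn
      nlinarith [hpos x hk]
  · rw [abs_of_neg h] at hc ⊢
    rcases le_or_gt (-c) δ with h' | h'
    · nlinarith
    · have hk : x ≤ -κ := le_of_mul_le_mul_left (by nlinarith) hn
      nlinarith [hneg x hk]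

/-- The vector field of the Liénard plane `ζ = n x + i y` in rotating coordinates
`w = exp (i n t) ζ`, for a damping primitive `Φ`. -/
noncomputable def rotatingField (Φ e : ℝ → ℝ) (n : ℕ) (t : ℝ) (w : ℂ) : ℂ :=
  Complex.exp ((n * t : ℝ) * Complex.I) *
    (((-(n * Φ ((Complex.exp (-((n * t : ℝ) * Complex.I)) * w).re / n)) : ℝ) : ℂ) +
      (e t : ℂ) * Complex.I)

section rotatingField

variable {Φ e : ℝ → ℝ} {n : ℕ}

theorem continuous_rotatingField (hΦ : Continuous Φ) (he : Continuous e) :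
    Continuous fun p : ℝ × ℂ => rotatingField Φ e n p.1 p.2 := by
  unfold rotatingField
  fun_prop

theorem norm_exp_neg_ofReal_mul_I (s : ℝ) : ‖Complex.exp (-(s * Complex.I))‖ = 1 := by
  rw [← neg_mul, ← Complex.ofReal_neg, Complex.norm_exp_ofReal_mul_I]

theorem norm_rotatingField_le {B E : ℝ} (hB : ∀ y, |Φ y| ≤ B) (hE : ∀ t, |e t| ≤ E)
    (t : ℝ) (w : ℂ) : ‖rotatingField Φ e n t w‖ ≤ n * B + E := by
  rw [rotatingField, norm_mul, Complex.norm_exp_ofReal_mul_I, one_mul]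
  refine (norm_add_le _ _).trans (add_le_add ?_ ?_)
  · rw [Complex.norm_real, norm_neg, norm_mul, Real.norm_natCast]
    exact mul_le_mul_of_nonneg_left (hB _) n.cast_nonneg
  · simpa using hE t

/-- Rotations are isometries, and the factor `n` cancels the division by `n` inside `Φ`. -/
theorem lipschitzWith_rotatingField (hn : 1 ≤ n) {K : NNReal} (hK : LipschitzWith K Φ) (t : ℝ) :
    LipschitzWith K (rotatingField Φ e n t) := by
  have hn0 : (0 : ℝ) < n := by positivity
  refine LipschitzWith.of_dist_le_mul fun z w => ?_
  rw [dist_eq_norm, dist_eq_norm, rotatingField, rotatingField, ← mul_sub, norm_mul,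
    Complex.norm_exp_ofReal_mul_I, one_mul, add_sub_add_right_eq_sub, ← Complex.ofReal_sub,
    Complex.norm_real, neg_sub_neg, ← mul_sub, norm_mul, Real.norm_natCast, ← dist_eq_norm,
    dist_comm]
  refine (mul_le_mul_of_nonneg_left (hK.dist_le_mul _ _) n.cast_nonneg).trans ?_
  rw [Real.dist_eq, ← sub_div, ← Complex.sub_re, ← mul_sub, abs_div, abs_of_pos hn0]
  have h := Complex.abs_re_le_norm (Complex.exp (-((n * t : ℝ) * Complex.I)) * (z - w))
  rw [norm_mul, norm_exp_neg_ofReal_mul_I, one_mul] at h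
  rw [mul_left_comm, mul_div_cancel₀ _ hn0.ne']
  exact mul_le_mul_of_nonneg_left h K.2

theorem rotatingField_add_two_pi (he : Function.Periodic e (2 * Real.pi)) (t : ℝ) (w : ℂ) :
    rotatingField Φ e n (t + 2 * Real.pi) w = rotatingField Φ e n t w := by
  have h : Complex.exp ((n * (t + 2 * Real.pi) : ℝ) * Complex.I) =
      Complex.exp ((n * t : ℝ) * Complex.I) := by
    rw [Complex.exp_eq_exp_iff_exists_int]
    exact ⟨n, by push_cast; ring⟩
  rw [rotatingField, rotatingField, he, Complex.exp_neg, Complex.exp_neg, h]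

theorem re_rotatingField_mul_conj (r θ t : ℝ) (w : ℂ) :
    (rotatingField Φ e n t w * (starRingEnd ℂ) (r * Complex.exp (θ * Complex.I))).re =
      r * (e t * Real.cos (n * t - (θ - Real.pi / 2)) - n *
        (Φ ((Complex.exp (-((n * t : ℝ) * Complex.I)) * w).re / n) * Real.cos (n * t - θ))) := by
  have h : rotatingField Φ e n t w * (starRingEnd ℂ) (r * Complex.exp (θ * Complex.I)) =
      r * (Complex.exp ((n * t - θ : ℝ) * Complex.I) *
        (((-(n * Φ ((Complex.exp (-((n * t : ℝ) * Complex.I)) * w).re / n)) : ℝ) : ℂ) +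
      (e t : ℂ) * Complex.I)) := by
    have h1 : ((n * t - θ : ℝ) : ℂ) * Complex.I =
        (n * t : ℝ) * Complex.I + -(θ * Complex.I) := by
      push_cast
      ring
    rw [h1, Complex.exp_add, rotatingField, map_mul, ← Complex.exp_conj, map_mul,
      Complex.conj_ofReal, Complex.conj_ofReal, Complex.conj_I, mul_neg]
    ring
  rw [h, Complex.re_ofReal_mul, Complex.mul_re, Complex.exp_ofReal_mul_I_re,
    Complex.exp_ofReal_mul_I_im, ← sub_add, Real.cos_add_pi_div_two]
  simp only [Complex.add_re, Complex.add_im, Complex.ofReal_re, Complex.ofReal_im,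
    Complex.re_ofReal_mul, Complex.im_ofReal_mul, Complex.I_re, Complex.I_im]
  ring

/-- For large `r`, orbits in rotating coordinates issued from the circle of radius `r` are
displaced inwards after the time `2π`. -/
theorem re_sub_mul_conj_neg_of_norm_eq (hn : 1 ≤ n) (hΦc : Continuous Φ) (he : Continuous e)
    {a b ε δ κ L r : ℝ} (hΦ : ∀ y, b < Φ y ∧ Φ y < a) (hε : 0 ≤ ε) (hδ : 0 ≤ δ)
    (hpos : ∀ y, κ ≤ y → a - ε ≤ Φ y) (hneg : ∀ y, y ≤ -κ → Φ y ≤ b + ε)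
    (hL : ∀ t w, ‖rotatingField Φ e n t w‖ ≤ L) (hr0 : 0 < r)
    (hr : L * (2 * Real.pi) + n * κ ≤ r * δ)
    (hgap : Real.sqrt (cosCoeff e n ^ 2 + sinCoeff e n ^ 2) +
      n * (2 * Real.pi * (ε + (a - b) * δ)) < 2 * n * (a - b))
    {w : ℝ → ℂ} (hw0 : ‖w 0‖ = r)
    (hw : ∀ t ∈ Set.Icc 0 (2 * Real.pi),
      HasDerivWithinAt w (rotatingField Φ e n t (w t)) (Set.Icc 0 (2 * Real.pi)) t) :
    ((w (2 * Real.pi) - w 0) * (starRingEnd ℂ) (w 0)).re < 0 := by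
  have hn0 : (0 : ℝ) < n := by positivity
  obtain ⟨θ, hθ⟩ : ∃ θ : ℝ, w 0 = r * Complex.exp (θ * Complex.I) :=
    ⟨(w 0).arg, by rw [← hw0, Complex.norm_mul_exp_arg_mul_I]⟩
  have hwc : ContinuousOn w (Set.Icc 0 (2 * Real.pi)) := fun t ht => (hw t ht).continuousWithinAt
  have hu : Set.uIcc 0 (2 * Real.pi) = Set.Icc 0 (2 * Real.pi) :=
    Set.uIcc_of_le Real.two_pi_pos.le
  let X : ℝ → ℝ := fun t => (Complex.exp (-((n * t : ℝ) * Complex.I)) * w t).re / n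
  have hXc : ContinuousOn X (Set.Icc 0 (2 * Real.pi)) := by
    refine (Complex.continuous_re.comp_continuousOn (ContinuousOn.mul ?_ hwc)).div_const _
    exact Continuous.continuousOn (by fun_prop)
  have hΦX : ContinuousOn (fun t => Φ (X t) * Real.cos (n * t - θ))
      (Set.Icc 0 (2 * Real.pi)) :=
    (hΦc.comp_continuousOn hXc).mul (Continuous.continuousOn (by fun_prop))
  have hderiv : ∀ t ∈ Set.Icc 0 (2 * Real.pi), HasDerivWithinAt
      (fun t => (w t * (starRingEnd ℂ) (w 0)).re)
      (r * (e t * Real.cos (n * t - (θ - Real.pi / 2)) -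
        n * (Φ (X t) * Real.cos (n * t - θ)))) (Set.Icc 0 (2 * Real.pi)) t := by
    intro t ht
    have h := Complex.reCLM.hasFDerivAt.comp_hasDerivWithinAt t
      ((hw t ht).mul_const ((starRingEnd ℂ) (w 0)))
    refine h.congr_deriv ?_
    rw [Complex.reCLM_apply]
    rw [hθ]
    exact re_rotatingField_mul_conj r θ t (w t)
  have hi1 : IntervalIntegrable (fun t => e t * Real.cos (n * t - (θ - Real.pi / 2)))
      MeasureTheory.volume 0 (2 * Real.pi) := Continuous.intervalIntegrable (by fun_prop) _ _
  have hi2 : IntervalIntegrable (fun t => Φ (X t) * Real.cos (n * t - θ))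
      MeasureTheory.volume 0 (2 * Real.pi) := ContinuousOn.intervalIntegrable (by rwa [hu])
  have hFTC := intervalIntegral.integral_eq_sub_of_hasDerivAt_of_le Real.two_pi_pos.le
    (fun t ht => (hderiv t ht).continuousWithinAt)
    (fun t ht => (hderiv t (Set.Ioo_subset_Icc_self ht)).hasDerivAt (Icc_mem_nhds ht.1 ht.2))
    ((hi1.sub (hi2.const_mul _)).const_mul _)
  rw [sub_mul, Complex.sub_re, ← hFTC, intervalIntegral.integral_const_mul,
    intervalIntegral.integral_sub hi1 (hi2.const_mul _), intervalIntegral.integral_const_mul]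
  have h1 := integral_mul_cos_le_sqrt he n (θ - Real.pi / 2)
  have h2 : 2 * (a - b) - 2 * Real.pi * (ε + (a - b) * δ) ≤
      ∫ t in (0 : ℝ)..2 * Real.pi, Φ (X t) * Real.cos (n * t - θ) := by
    have hc : ∫ _ in (0 : ℝ)..2 * Real.pi, (ε + (a - b) * δ) =
        2 * Real.pi * (ε + (a - b) * δ) := by
      rw [intervalIntegral.integral_const, smul_eq_mul, sub_zero]
    rw [← integral_weighted_abs_cos_add_cos hn a b θ, ← hc, ← intervalIntegral.integral_sub
      (Continuous.intervalIntegrable (by fun_prop) _ _) (by simp)]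
    refine intervalIntegral.integral_mono_on Real.two_pi_pos.le
      (Continuous.intervalIntegrable (by fun_prop) _ _) hi2 fun t ht => ?_
    refine weighted_abs_add_sub_le_mul hn0 hΦ hε hδ hpos hneg (Real.abs_cos_le_one _) ?_
      hr0.le hr
    -- The deviation from the pure cosine is the rotated displacement of `w`, bounded by speed times
    -- period.
    have hX : n * X t - r * Real.cos (n * t - θ) =
        (Complex.exp (-((n * t : ℝ) * Complex.I)) * (w t - w 0)).re := by
      have h0 : Complex.exp (-((n * t : ℝ) * Complex.I)) * w 0 =
          r * Complex.exp ((θ - n * t : ℝ) * Complex.I) := by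
        rw [hθ, mul_left_comm, ← Complex.exp_add]
        push_cast
        ring_nf
      rw [mul_sub, Complex.sub_re, h0, Complex.re_ofReal_mul, Complex.exp_ofReal_mul_I_re,
        ← Real.cos_neg (θ - n * t), neg_sub]
      simp only [X]
      rw [mul_div_cancel₀ _ hn0.ne']
    rw [hX]
    refine (Complex.abs_re_le_norm _).trans ?_
    rw [norm_mul, norm_exp_neg_ofReal_mul_I, one_mul]
    exact norm_sub_le_of_hasDerivWithinAt hL hw ht
  have h3 := mul_le_mul_of_nonneg_left h2 hn0.le
  exact mul_neg_of_pos_of_neg hr0 (by linarith)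

/-- Periodic orbits in rotating coordinates that stay where `Φ` agrees with the damping primitive
yield periodic solutions of the scalar equation. -/
theorem isPeriodicSolution_of_orbit (hn : 1 ≤ n) {f : ℝ → ℝ} (hf : Continuous f)
    (he : Continuous e) {W : ℝ → ℂ} (hW : ∀ t, HasDerivAt W (rotatingField Φ e n t (W t)) t)
    (hWp : Function.Periodic W (2 * Real.pi))
    (hΦ : ∀ t, Φ ((Complex.exp (-((n * t : ℝ) * Complex.I)) * W t).re / n) =
      dampingPrimitive f ((Complex.exp (-((n * t : ℝ) * Complex.I)) * W t).re / n)) :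
    IsPeriodicSolution f e n
      fun t => (Complex.exp (-((n * t : ℝ) * Complex.I)) * W t).re / n := by
  have hn0 : (n : ℝ) ≠ 0 := by positivity
  let ζ : ℝ → ℂ := fun t => Complex.exp (-((n * t : ℝ) * Complex.I)) * W t
  let x : ℝ → ℝ := fun t => (ζ t).re / n
  change IsPeriodicSolution f e n x
  have hζ : ∀ t, HasDerivAt ζ (-(n * Complex.I) * ζ t +
      (((-(n * dampingPrimitive f (x t)) : ℝ) : ℂ) + (e t : ℂ) * Complex.I)) t := by
    intro t
    have hlin : HasDerivAt (fun t : ℝ => -(((n * t : ℝ) : ℂ) * Complex.I))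
        (-(n * Complex.I)) t := by
      have h := (((hasDerivAt_id t).const_mul (n : ℝ)).ofReal_comp.mul_const Complex.I).neg
      refine h.congr_deriv ?_
      simp
    refine (hlin.cexp.mul (hW t)).congr_deriv ?_
    rw [rotatingField, hΦ t, ← mul_assoc, ← Complex.exp_add, neg_add_cancel, Complex.exp_zero,
      one_mul]
    simp only [x, ζ]
    ring
  have hxd : ∀ t, HasDerivAt x ((ζ t).im - dampingPrimitive f (x t)) t := by
    intro t
    refine ((Complex.reCLM.hasFDerivAt.comp_hasDerivAt t (hζ t)).div_const (n : ℝ)).congr_deriv ?_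
    rw [Complex.reCLM_apply]
    simp
    field_simp
    ring
  have hyd : ∀ t, HasDerivAt (fun t => (ζ t).im) (-(n ^ 2 * x t) + e t) t := by
    intro t
    refine (Complex.imCLM.hasFDerivAt.comp_hasDerivAt t (hζ t)).congr_deriv ?_
    rw [Complex.imCLM_apply]
    simp only [x]
    simp
    field_simp
  have hdx : deriv x = fun t => (ζ t).im - dampingPrimitive f (x t) :=
    funext fun t => (hxd t).deriv
  have hxc : Continuous x := continuous_iff_continuousAt.mpr fun t => (hxd t).continuousAt
  have hx'c : Continuous (deriv x) := by
    rw [hdx]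
    have h1 : Continuous fun t => (ζ t).im :=
      continuous_iff_continuousAt.mpr fun t => (hyd t).continuousAt
    have h2 : Continuous (dampingPrimitive f) :=
      continuous_iff_continuousAt.mpr fun y => (hasDerivAt_dampingPrimitive hf y).continuousAt
    fun_prop
  -- Differentiating `x' = y - F(x)` recovers the scalar equation and the continuity of `x''`.
  have hxdd : ∀ t, HasDerivAt (deriv x) (-(n ^ 2 * x t) + e t - f (x t) * deriv x t) t := by
    intro t
    have h := (hyd t).sub ((hasDerivAt_dampingPrimitive hf (x t)).comp t (hxd t))
    rw [hdx]
    exact h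
  refine ⟨?_, ?_, fun t => ?_⟩
  · refine (contDiff_succ_iff_deriv (n := 1)).mpr
      ⟨fun t => (hxd t).differentiableAt, by simp, contDiff_one_iff_deriv.mpr
        ⟨fun t => (hxdd t).differentiableAt, ?_⟩⟩
    rw [funext fun t => (hxdd t).deriv]
    fun_prop
  · intro t
    have h : Complex.exp (-((n * (t + 2 * Real.pi) : ℝ) * Complex.I)) =
        Complex.exp (-((n * t : ℝ) * Complex.I)) := by
      rw [Complex.exp_eq_exp_iff_exists_int]
      exact ⟨-n, by push_cast; ring⟩
    simp only [x, ζ, h, hWp t]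
  · rw [(hxdd t).deriv]
    ring

end rotatingField

/-! ### Truncation and choice of constants. -/

/-- `f` may be unbounded, so `F` need not be globally Lipschitz; on `[-M, M]` it is, and the clamp
is `1`-Lipschitz. -/
theorem exists_lipschitzWith_comp_clamp {F f : ℝ → ℝ} (hf : Continuous f)
    (hF : ∀ x, HasDerivAt F (f x) x) {M : ℝ} (hM : 0 ≤ M) :
    ∃ K, LipschitzWith K fun y => F (max (-M) (min M y)) := by
  obtain ⟨K, hK⟩ := isCompact_Icc.exists_bound_of_continuousOn (s := Set.Icc (-M) M)
    hf.continuousOn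
  have h1 : LipschitzOnWith K.toNNReal F (Set.Icc (-M) M) :=
    (convex_Icc _ _).lipschitzOnWith_of_nnnorm_hasDerivWithin_le
      (fun x _ => (hF x).hasDerivWithinAt) fun x hx => by
        rw [← NNReal.coe_le_coe, coe_nnnorm]
        exact (hK x hx).trans (Real.le_coe_toNNReal K)
  have h2 : LipschitzWith 1 fun y : ℝ => max (-M) (min M y) :=
    (LipschitzWith.id.const_min M).const_max (-M)
  refine ⟨K.toNNReal * 1, ?_⟩
  rw [← lipschitzOnWith_univ] at h2 ⊢
  exact h1.comp h2 fun y _ => ⟨le_max_left _ _, max_le (by linarith) (min_le_left _ _)⟩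

theorem exists_isPeriodicSolution_of_sqrt_lt {n : ℕ} (hn : 1 ≤ n) {f e : ℝ → ℝ}
    (hf : Continuous f) (he : Continuous e) (hper : Function.Periodic e (2 * Real.pi))
    {Fneg Fpos : ℝ}
    (hneg : Filter.Tendsto (dampingPrimitive f) Filter.atBot (nhds Fneg))
    (hpos : Filter.Tendsto (dampingPrimitive f) Filter.atTop (nhds Fpos))
    (hF : ∀ x : ℝ, Fneg < dampingPrimitive f x ∧ dampingPrimitive f x < Fpos)
    (hlt : Real.sqrt (cosCoeff e n ^ 2 + sinCoeff e n ^ 2) < 2 * (n : ℝ) * (Fpos - Fneg)) :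
    ∃ x : ℝ → ℝ, IsPeriodicSolution f e n x := by
  have hn0 : (0 : ℝ) < n := by positivity
  have hD : 0 < Fpos - Fneg := by linarith [hF 0]
  obtain ⟨E, hE⟩ : ∃ E, ∀ t, |e t| ≤ E := by
    obtain ⟨E, hE⟩ := isCompact_Icc.exists_bound_of_continuousOn
      (s := Set.Icc 0 (2 * Real.pi)) he.continuousOn
    refine ⟨E, fun t => ?_⟩
    obtain ⟨s, hs, h⟩ := hper.exists_mem_Ico₀ Real.two_pi_pos t
    rw [h]
    exact hE s (Set.Ico_subset_Icc_self hs)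
  have hE0 : 0 ≤ E := (abs_nonneg _).trans (hE 0)
  set B := max |Fneg| |Fpos|
  have hB0 : 0 ≤ B := (abs_nonneg _).trans (le_max_left _ _)
  set L := n * B + E
  have hL0 : 0 ≤ L := by positivity
  set γ := 2 * (n : ℝ) * (Fpos - Fneg) - Real.sqrt (cosCoeff e n ^ 2 + sinCoeff e n ^ 2) with hγ
  have hγ0 : 0 < γ := sub_pos.mpr hlt
  have hpi := Real.pi_pos
  -- With `(Fpos - Fneg) * δ = ε`, the total error `n * 2π * 2ε` is half the gap `γ`.
  set ε := γ / (8 * Real.pi * n) with hε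
  have hε0 : 0 < ε := by positivity
  set δ := ε / (Fpos - Fneg) with hδ
  have hδ0 : 0 < δ := by positivity
  have hgap : Real.sqrt (cosCoeff e n ^ 2 + sinCoeff e n ^ 2) +
      n * (2 * Real.pi * (ε + (Fpos - Fneg) * δ)) < 2 * n * (Fpos - Fneg) := by
    have h1 : (Fpos - Fneg) * δ = ε := mul_div_cancel₀ _ hD.ne'
    have h2 : n * (2 * Real.pi * (ε + ε)) = γ / 2 := by
      rw [hε]
      field_simp
      norm_num
    rw [h1, h2]
    linarith
  obtain ⟨κ₁, hκ₁⟩ := Filter.eventually_atTop.mp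
    (hpos.eventually_const_le (show Fpos - ε < Fpos by linarith))
  obtain ⟨κ₂, hκ₂⟩ := Filter.eventually_atBot.mp
    (hneg.eventually_le_const (show Fneg < Fneg + ε by linarith))
  set κ := max 0 (max κ₁ (-κ₂))
  have hκ0 : 0 ≤ κ := le_max_left _ _
  have hκ1 : κ₁ ≤ κ := (le_max_left _ _).trans (le_max_right _ _)
  have hκ2 : -κ₂ ≤ κ := (le_max_right _ _).trans (le_max_right _ _)
  set r := (L * (2 * Real.pi) + n * κ) / δ + 1
  have hr0 : 0 < r := by positivity
  have hr : L * (2 * Real.pi) + n * κ ≤ r * δ := by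
    rw [show r * δ = _ from add_mul _ _ _, div_mul_cancel₀ _ hδ0.ne']
    linarith
  -- `M ≥ κ` keeps the estimates near the limits valid after clamping; the other bound dominates
  -- `|x|` along the periodic orbit, where the clamp is therefore inactive.
  set M := max κ ((r + L * (2 * Real.pi)) / n)
  have hM0 : 0 ≤ M := hκ0.trans (le_max_left _ _)
  have hMκ : κ ≤ M := le_max_left _ _
  let Φ : ℝ → ℝ := fun y => dampingPrimitive f (max (-M) (min M y))
  obtain ⟨K, hK⟩ := exists_lipschitzWith_comp_clamp hf (hasDerivAt_dampingPrimitive hf) hM0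
  have hΦpos : ∀ y, κ ≤ y → Fpos - ε ≤ Φ y := fun y hy =>
    hκ₁ _ (hκ1.trans (le_max_of_le_right (le_min hMκ hy)))
  have hΦneg : ∀ y, y ≤ -κ → Φ y ≤ Fneg + ε := fun y hy =>
    hκ₂ _ (max_le (by linarith) (min_le_of_right_le (by linarith)))
  have hL : ∀ t w, ‖rotatingField Φ e n t w‖ ≤ L := norm_rotatingField_le (fun y =>
    abs_le_max_abs_abs (hF _).1.le (hF _).2.le) hE
  have hGc := continuous_rotatingField (n := n) hK.continuous he
  obtain ⟨w, hwr, hret, hw⟩ := exists_orbit_return Real.two_pi_pos.le hr0 hGc hL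
    (lipschitzWith_rotatingField hn hK) fun w hw0 hw =>
      re_sub_mul_conj_neg_of_norm_eq hn hK.continuous he (fun y => hF _) hε0.le hδ0.le
        hΦpos hΦneg hL hr0 hr hgap hw0 hw
  obtain ⟨W, hWp, hWw, hW⟩ := exists_periodic_orbit_of_return Real.two_pi_pos hGc
    (rotatingField_add_two_pi hper) hw hret
  refine ⟨_, isPeriodicSolution_of_orbit hn hf he hW hWp fun t => ?_⟩
  set x := (Complex.exp (-((n * t : ℝ) * Complex.I)) * W t).re / n
  have hx : |x| ≤ M := by
    obtain ⟨s, hs, h⟩ := hWp.exists_mem_Ico₀ Real.two_pi_pos t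
    have hs' := Set.Ico_subset_Icc_self hs
    have hWt : ‖W t‖ ≤ r + L * (2 * Real.pi) := by
      rw [h, hWw hs', ← add_sub_cancel (w 0) (w s)]
      exact (norm_add_le _ _).trans
        (add_le_add hwr (norm_sub_le_of_hasDerivWithinAt hL hw hs'))
    refine le_trans ?_ (le_max_right _ _)
    rw [abs_div, abs_of_pos hn0]
    refine div_le_div_of_nonneg_right ((Complex.abs_re_le_norm _).trans ?_) hn0.le
    rwa [norm_mul, norm_exp_neg_ofReal_mul_I, one_mul]
  obtain ⟨hx1, hx2⟩ := abs_le.mp hx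
  change dampingPrimitive f (max (-M) (min M x)) = _
  rw [min_eq_right hx2, max_eq_right hx1]

theorem theorem1 (n : ℕ) (hn : 1 ≤ n) (f e : ℝ → ℝ)
    (hf : Continuous f) (he : Continuous e) (hper : Function.Periodic e (2 * Real.pi))
    (Fneg Fpos : ℝ)
    (hneg : Filter.Tendsto (dampingPrimitive f) Filter.atBot (nhds Fneg))
    (hpos : Filter.Tendsto (dampingPrimitive f) Filter.atTop (nhds Fpos))
    (hF : ∀ x : ℝ, Fneg < dampingPrimitive f x ∧ dampingPrimitive f x < Fpos) :
    (∃ x : ℝ → ℝ, IsPeriodicSolution f e n x) ↔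
      Real.sqrt (cosCoeff e n ^ 2 + sinCoeff e n ^ 2) < 2 * (n : ℝ) * (Fpos - Fneg) :=
  ⟨fun ⟨_, hx⟩ => sqrt_lt_of_isPeriodicSolution hn hf he hF hx,
    exists_isPeriodicSolution_of_sqrt_lt hn hf he hper hneg hpos hF⟩
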